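/- Let $X$ be a finite set partitioned into two (possibly empty) parts $X = X_1 \cup X_2$. Call a set system intersecting if any two distinct members have nonempty intersection, and Sperner if no member is contained in a different member. A family $\mathcal F \subseteq 2^X$ is called 2-part intersecting, 2-part Sperner (a 2I2S-system) with respect to $X_1, X_2$ if for every $A \subseteq X_1$ the trace system $\mathcal F_A = \{F \cap X_2 : F \in \mathcal F,\ F \cap X_1 = A\}$ and for every $B \subseteq X_2$ the trace system $\mathcal F_B = \{F \cap X_1 : F \in \mathcal F,\ F \cap X_2 = B\}$ are both intersecting and Sperner. (1) Every 2I2S-system $\mathcal F \subseteq 2^X$ satisfies $|\mathcal F| \le \binom{|X|}{\lceil |X|/2 \rceil}$. (2) This bound is asymptotically sharp when $|X_1| = o(|X_2|^{1/2})$: for every sequence of finite sets $X^{(k)} = X_1^{(k)} \cup X_2^{(k)}$, each partitioned into two parts, with $|X^{(k)}| \to \infty$ and $|X_1^{(k)}| = o(|X_2^{(k)}|^{1/2})$ as $k \to \infty$, there are 2I2S-systems $\mathcal F^{(k)} \subseteq 2^{X^{(k)}}$ with respect to $X_1^{(k)}, X_2^{(k)}$ such that $|\mathcal F^{(k)}|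 \big/ \binom{|X^{(k)}|}{\lceil |X^{(k)}|/2 \rceil} \to 1$. (3) There are a constant $c > 2/3$ and an integer $N$ such that whenever $|X_1| = |X_2| \ge N$, there exists a 2I2S-system $\mathcal F \subseteq 2^X$ with $|\mathcal F| \ge c \binom{|X|}{\lceil |X|/2 \rceil}$. -/

import Mathlib

open Filter Asymptotics Topology

universe u

namespace TwoPart

/-- A set system is intersecting if any two distinct members meet
(so a system with a single member, even the empty set, is intersecting). -/
def IsIntersecting {α : Type*} [DecidableEq α] (G : Finset (Finset α)) : Prop :=
  ∀ A ∈ G, ∀ B ∈ G, A ≠ B → (A ∩ B).Nonempty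

/-- A set system is Sperner if no member is contained in a different member. -/
def IsSperner {α : Type*} (G : Finset (Finset α)) : Prop :=
  ∀ A ∈ G, ∀ B ∈ G, A ≠ B → ¬ A ⊆ B

/-- The trace system on `Z` over a subset `A` of `Y`:
all `S ∩ Z` where `S` runs over the members of `F` with `S ∩ Y = A`. -/
def traceSystem {α : Type*} [DecidableEq α] (F : Finset (Finset α)) (Y Z A : Finset α) :
    Finset (Finset α) :=
  (F.filter (fun S => S ∩ Y = A)).image (fun S => S ∩ Z)

/-- `F` is a 2-part intersecting, 2-part Sperner system of subsets of `X₁ ∪ X₂`,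
with respect to the two parts `X₁` and `X₂`. -/
structure Is2I2S {α : Type*} [DecidableEq α] (X₁ X₂ : Finset α) (F : Finset (Finset α)) :
    Prop where
  subset : ∀ S ∈ F, S ⊆ X₁ ∪ X₂
  left : ∀ A ⊆ X₁, IsIntersecting (traceSystem F X₁ X₂ A) ∧ IsSperner (traceSystem F X₁ X₂ A)
  right : ∀ B ⊆ X₂, IsIntersecting (traceSystem F X₂ X₁ B) ∧ IsSperner (traceSystem F X₂ X₁ B)

/-- The binomial coefficient `n` over `⌈n / 2⌉`, as `(n + 1) / 2` rounded down is `⌈n / 2⌉`. -/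
def middleBinom (n : ℕ) : ℕ := n.choose ((n + 1) / 2)

end TwoPart

/-! The upper bound needs only the Sperner conditions. Split the power set of each part into
symmetric chains. Inside a product of two chains, a member of the family is determined by its trace
on the shorter chain, while the middle level of the product contains one set for every member of
that chain. Summing over all products gives the bound.

Both constructions relate sets `A ⊆ X₁` and `B ⊆ X₂` so that either one fixes the size of the other.
The Sperner conditions are then automatic (`is2I2S_systemOfRel`), and only intersection is at stake.

Small first part: group the sets `A` by cardinality and least element, so that a class is
intersecting, and give each class its own level of `X₂` just above the middle, where sets meet
because of their size. Dropping the `A` whose least element exceeds `t` loses a fraction of at most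
`2 ^ -(t + 1)`; the levels used lie within `o(√|X₂|)` of the middle, hence are nearly as large as
the middle one.

Equal parts of size `n`: take `|A| = |B|`. Above half size every pair is allowed, which yields about
half of `C(2n, n) = ∑ C(n, k)²`. In the other half, allow the pairs whose traces on three marked
points lie in `typePairs`, 22 of the 64 possibilities. The proportion is `(1 + 22/64) / 2 = 86/128 >
2/3`. -/

namespace TwoPart

/-! ### Symmetric chain decompositions -/

/-- `κ` labels the subsets of `X` by the members of a symmetric chain decomposition:
the chain with label `c` has exactly one member of each cardinality from `c.count true`
to `X.card - c.count true`. -/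
structure IsSymmetricChainCode {α : Type*} (X : Finset α) (κ : Finset α → List Bool) : Prop where
  le_card : ∀ S ⊆ X, (κ S).count true ≤ S.card
  card_le : ∀ S ⊆ X, S.card + (κ S).count true ≤ X.card
  chain : ∀ S ⊆ X, ∀ T ⊆ X, κ S = κ T → S.card ≤ T.card → S ⊆ T
  exists_card : ∀ S ⊆ X, ∀ r, (κ S).count true ≤ r → r + (κ S).count true ≤ X.card →
    ∃ T ⊆ X, κ T = κ S ∧ T.card = r

/-- The classical induction: a chain over `X` yields two over `insert a X`, namely the chain
extended by its top with `a` added (flag `false`), and all members but the top, each with `a` added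
(flag `true`). The second starts one level higher, so counting `true` flags gives the least size in
a chain. -/
theorem exists_isSymmetricChainCode {α : Type*} [DecidableEq α] (X : Finset α) :
    ∃ κ : Finset α → List Bool, IsSymmetricChainCode X κ := by
  induction X using Finset.induction_on with
  | empty =>
    refine ⟨fun _ => [], ?_, ?_, ?_, ?_⟩
    · simp
    · simp
    · intro S hS T _ _ _
      simp_all
    · intro S hS r _ hr
      refine ⟨∅, by simp, rfl, ?_⟩
      simp at hr
      simp [hr]
  | insert a X ha ih =>
    obtain ⟨κ, h1, h2, h3, h4⟩ := ih
    let flag : Finset α → Bool := fun S =>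
      decide (a ∈ S ∧ (S.erase a).card + (κ (S.erase a)).count true < X.card)
    have sub : ∀ S ⊆ insert a X, S.erase a ⊆ X := fun S hS => by
      rwa [← Finset.subset_insert_iff]
    have hX : (insert a X).card = X.card + 1 := Finset.card_insert_of_notMem ha
    have hcard : ∀ S : Finset α, a ∈ S → S.card = (S.erase a).card + 1 := fun S hS =>
      (Finset.card_erase_add_one hS).symm
    have hins : ∀ T ⊆ X, (insert a T).erase a = T := fun T hT =>
      Finset.erase_insert (fun h => ha (hT h))
    have hera : ∀ T ⊆ X, T.erase a = T := fun T hT =>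
      Finset.erase_eq_of_notMem (fun h => ha (hT h))
    have ft : ∀ S, flag S = true ↔
        (a ∈ S ∧ (S.erase a).card + (κ (S.erase a)).count true < X.card) := fun S => by
      simp [flag]
    refine ⟨fun S => flag S :: κ (S.erase a), ?_, ?_, ?_, ?_⟩
    · intro S hS
      have := h1 _ (sub S hS)
      have h' := ft S
      have hle := Finset.card_erase_le (s := S) (a := a)
      cases hf : flag S
      · simp; omega
      · rw [hf] at h'
        have hc := hcard S (h'.1 rfl).1
        simp; omega
    · intro S hS
      have := h2 _ (sub S hS)
      have h' := ft S
      cases hf : flag S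
      · by_cases haS : a ∈ S
        · have hc := hcard S haS
          simp; omega
        · rw [Finset.erase_eq_of_notMem haS] at this ⊢
          simp; omega
      · rw [hf] at h'
        have hc := hcard S (h'.1 rfl).1
        have := (h'.1 rfl).2
        simp; omega
    · intro S hS T hT he hle
      simp only [List.cons.injEq] at he
      obtain ⟨hfl, hk⟩ := he
      have hS2 := h2 _ (sub S hS)
      have hT2 := h2 _ (sub T hT)
      by_cases haS : a ∈ S <;> by_cases haT : a ∈ T
      · have := h3 _ (sub S hS) _ (sub T hT) hk (by
          have := hcard S haS; have := hcard T haT; omega)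
        rw [← Finset.insert_erase haS, ← Finset.insert_erase haT]
        exact Finset.insert_subset_insert _ this
      · exfalso
        have hfT : flag T = false := by simp [flag, haT]
        rw [hfT] at hfl
        have hn : ¬ (a ∈ S ∧ (S.erase a).card + (κ (S.erase a)).count true < X.card) := by
          rw [← ft, hfl]; simp
        have := hcard S haS
        rw [Finset.erase_eq_of_notMem haT] at hT2
        rw [Finset.erase_eq_of_notMem haT] at hk
        rw [hk] at hS2
        simp only [haS, true_and, hk] at hn
        omega
      · have hfS : flag S = false := by simp [flag, haS]
        rw [hfS] at hfl
        have hn : ¬ (a ∈ T ∧ (T.erase a).card + (κ (T.erase a)).count true < X.card) := by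
          rw [← ft, ← hfl]; simp
        rw [Finset.erase_eq_of_notMem haS] at hk hS2
        have := h3 S (by simpa [Finset.erase_eq_of_notMem haS] using sub S hS) _ (sub T hT) hk (by
          simp only [haT, true_and] at hn
          rw [hk] at hS2
          omega)
        exact this.trans (Finset.erase_subset _ _)
      · have := h3 _ (sub S hS) _ (sub T hT) hk
        rw [Finset.erase_eq_of_notMem haS, Finset.erase_eq_of_notMem haT] at this
        exact this hle
    · intro S hS r hr1 hr2
      have hS1 := h1 _ (sub S hS)
      have hS2 := h2 _ (sub S hS)
      set c := (κ (S.erase a)).count true with hc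
      cases hf : flag S
      · simp only [hf, List.count_cons, ← hc] at hr1 hr2
        simp at hr1 hr2
        rw [hX] at hr2
        by_cases hr : r + c ≤ X.card
        · obtain ⟨T, hT, hTk, hTr⟩ := h4 _ (sub S hS) r hr1 hr
          have haT : a ∉ T := fun h => ha (hT h)
          refine ⟨T, hT.trans (Finset.subset_insert _ _), ?_, hTr⟩
          have : flag T = false := by simp [flag, haT]
          rw [this, hera T hT, hTk]
        -- Here `r = |X| + 1 - c`, the new top: the old top together with `a`.
        · obtain ⟨T, hT, hTk, hTr⟩ := h4 _ (sub S hS) (r - 1) (by omega) (by omega)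
          have haT : a ∉ T := fun h => ha (hT h)
          refine ⟨insert a T, Finset.insert_subset_insert _ hT, ?_, ?_⟩
          · have : flag (insert a T) = false := by
              simp only [flag, hins T hT, hTk, decide_eq_false_iff_not, not_and]
              intro _
              omega
            rw [this, hins T hT, hTk]
          · rw [Finset.card_insert_of_notMem haT]; omega
      · simp only [hf, List.count_cons, ← hc] at hr1 hr2
        simp at hr1 hr2
        rw [hX] at hr2
        obtain ⟨T, hT, hTk, hTr⟩ := h4 _ (sub S hS) (r - 1) (by omega) (by omega)
        have haT : a ∉ T := fun h => ha (hT h)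
        refine ⟨insert a T, Finset.insert_subset_insert _ hT, ?_, ?_⟩
        · have : flag (insert a T) = true := by
            rw [ft, hins T hT, hTk]
            exact ⟨Finset.mem_insert_self _ _, by omega⟩
          rw [this, hins T hT, hTk]
        · rw [Finset.card_insert_of_notMem haT]; omega

/-! ### The two-part Sperner bound -/

section Traces

variable {α : Type*} [DecidableEq α] {X₁ X₂ : Finset α} {F : Finset (Finset α)}

theorem mem_traceSystem {Y Z A B : Finset α} :
    B ∈ traceSystem F Y Z A ↔ ∃ S ∈ F, S ∩ Y = A ∧ S ∩ Z = B := by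
  simp [traceSystem, and_assoc]

theorem eq_of_inter_eq (hF : ∀ S ∈ F, S ⊆ X₁ ∪ X₂) {S T : Finset α} (hS : S ∈ F) (hT : T ∈ F)
    (h1 : S ∩ X₁ = T ∩ X₁) (h2 : S ∩ X₂ = T ∩ X₂) : S = T := by
  rw [← Finset.inter_eq_left.2 (hF S hS), ← Finset.inter_eq_left.2 (hF T hT),
    Finset.inter_union_distrib_left, Finset.inter_union_distrib_left, h1, h2]

theorem eq_of_sperner_trace (hF : ∀ S ∈ F, S ⊆ X₁ ∪ X₂)
    (h : ∀ A ⊆ X₁, IsSperner (traceSystem F X₁ X₂ A)) {S T : Finset α} (hS : S ∈ F) (hT : T ∈ F)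
    (h1 : S ∩ X₁ = T ∩ X₁) (h2 : S ∩ X₂ ⊆ T ∩ X₂) : S = T := by
  refine eq_of_inter_eq hF hS hT h1 ?_
  by_contra hne
  exact h (S ∩ X₁) Finset.inter_subset_right _ (mem_traceSystem.2 ⟨S, hS, rfl, rfl⟩) _
    (mem_traceSystem.2 ⟨T, hT, h1.symm, rfl⟩) hne h2

theorem union_inter_left {A B : Finset α} (hd : Disjoint X₁ X₂) (hA : A ⊆ X₁) (hB : B ⊆ X₂) :
    (A ∪ B) ∩ X₁ = A := by
  rw [Finset.union_inter_distrib_right, Finset.inter_eq_left.2 hA,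
    Finset.disjoint_iff_inter_eq_empty.1 (hd.symm.mono_left hB), Finset.union_empty]

theorem union_inter_right {A B : Finset α} (hd : Disjoint X₁ X₂) (hA : A ⊆ X₁) (hB : B ⊆ X₂) :
    (A ∪ B) ∩ X₂ = B := by
  rw [Finset.union_comm, union_inter_left hd.symm hB hA]

/-- The bound on the product of two symmetric chains, the first being the shorter one. -/
theorem card_filter_chain_le (hd : Disjoint X₁ X₂) (hF : ∀ S ∈ F, S ⊆ X₁ ∪ X₂)
    (h : ∀ A ⊆ X₁, IsSperner (traceSystem F X₁ X₂ A)) {κ₁ κ₂ : Finset α → List Bool}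
    (h₁ : IsSymmetricChainCode X₁ κ₁) (h₂ : IsSymmetricChainCode X₂ κ₂) (c d : List Bool)
    (hcd : X₁.card + 2 * d.count true ≤ X₂.card + 2 * c.count true) :
    (F.filter (fun S => κ₁ (S ∩ X₁) = c ∧ κ₂ (S ∩ X₂) = d)).card ≤
      (((X₁ ∪ X₂).powersetCard (((X₁ ∪ X₂).card + 1) / 2)).filter
        (fun S => κ₁ (S ∩ X₁) = c ∧ κ₂ (S ∩ X₂) = d)).card := by
  have hn : (X₁ ∪ X₂).card = X₁.card + X₂.card := Finset.card_union_of_disjoint hd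
  have key : ∀ S ∈ F.filter (fun S => κ₁ (S ∩ X₁) = c ∧ κ₂ (S ∩ X₂) = d),
      ∃ B ⊆ X₂, κ₂ B = d ∧ (S ∩ X₁).card + B.card = ((X₁ ∪ X₂).card + 1) / 2 := by
    intro S hS
    obtain ⟨_, hc, hd'⟩ := Finset.mem_filter.1 hS
    have a1 := h₁.le_card (S ∩ X₁) Finset.inter_subset_right
    have a2 := h₁.card_le (S ∩ X₁) Finset.inter_subset_right
    have b1 := h₂.le_card (S ∩ X₂) Finset.inter_subset_right
    have b2 := h₂.card_le (S ∩ X₂) Finset.inter_subset_right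
    rw [hc] at a1 a2
    rw [hd'] at b1 b2
    -- As the first chain is the shorter one, the size needed to reach the middle level is always
    -- available in the second chain.
    obtain ⟨B, hB, hk, hr⟩ := h₂.exists_card (S ∩ X₂) Finset.inter_subset_right
      (((X₁ ∪ X₂).card + 1) / 2 - (S ∩ X₁).card) (by rw [hd']; omega) (by rw [hd']; omega)
    exact ⟨B, hB, hk.trans hd', by omega⟩
  choose! g hg1 hg2 hg3 using key
  refine Finset.card_le_card_of_injOn (fun S => S ∩ X₁ ∪ g S) ?_ ?_
  · intro S hS
    have hS' := Finset.mem_coe.1 hS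
    have hu1 := union_inter_left hd (Finset.inter_subset_right (s₁ := S)) (hg1 S hS')
    have hu2 := union_inter_right hd (Finset.inter_subset_right (s₁ := S)) (hg1 S hS')
    rw [Finset.mem_coe, Finset.mem_filter, Finset.mem_powersetCard, hu1, hu2]
    refine ⟨⟨Finset.union_subset_union Finset.inter_subset_right (hg1 S hS'), ?_⟩,
      (Finset.mem_filter.1 hS').2.1, hg2 S hS'⟩
    rw [Finset.card_union_of_disjoint
      (hd.mono Finset.inter_subset_right (hg1 S hS')), hg3 S hS']
  · intro S hS T hT hST
    have hS' := Finset.mem_coe.1 hS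
    have hT' := Finset.mem_coe.1 hT
    have e : S ∩ X₁ = T ∩ X₁ := by
      rw [← union_inter_left hd (Finset.inter_subset_right (s₁ := S)) (hg1 S hS'),
        ← union_inter_left hd (Finset.inter_subset_right (s₁ := T)) (hg1 T hT')]
      exact congrArg (· ∩ X₁) hST
    obtain ⟨hSF, _, hSd⟩ := Finset.mem_filter.1 hS'
    obtain ⟨hTF, _, hTd⟩ := Finset.mem_filter.1 hT'
    -- The traces on `X₂` lie in one chain, so they are comparable, and the Sperner condition
    -- identifies them.
    rcases le_total (S ∩ X₂).card (T ∩ X₂).card with hle | hle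
    · exact eq_of_sperner_trace hF h hSF hTF e
        (h₂.chain _ Finset.inter_subset_right _ Finset.inter_subset_right (hSd.trans hTd.symm) hle)
    · exact (eq_of_sperner_trace hF h hTF hSF e.symm
        (h₂.chain _ Finset.inter_subset_right _ Finset.inter_subset_right
          (hTd.trans hSd.symm) hle)).symm

/-- The two-part Sperner theorem of Katona and Kleitman. -/
theorem card_le_middleBinom_of_sperner (hd : Disjoint X₁ X₂) (hF : ∀ S ∈ F, S ⊆ X₁ ∪ X₂)
    (hl : ∀ A ⊆ X₁, IsSperner (traceSystem F X₁ X₂ A))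
    (hr : ∀ B ⊆ X₂, IsSperner (traceSystem F X₂ X₁ B)) :
    F.card ≤ middleBinom (X₁ ∪ X₂).card := by
  obtain ⟨κ₁, h₁⟩ := exists_isSymmetricChainCode X₁
  obtain ⟨κ₂, h₂⟩ := exists_isSymmetricChainCode X₂
  set code : Finset α → List Bool × List Bool := fun S => (κ₁ (S ∩ X₁), κ₂ (S ∩ X₂))
  set M := (X₁ ∪ X₂).powersetCard (((X₁ ∪ X₂).card + 1) / 2)
  have hM : M.card = middleBinom (X₁ ∪ X₂).card := Finset.card_powersetCard _ _
  rw [← hM, Finset.card_eq_sum_card_fiberwise (f := code) (t := F.image code ∪ M.image code)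
      (fun S hS => by
        simpa using Or.inl ⟨S, hS, rfl⟩),
    Finset.card_eq_sum_card_fiberwise (s := M) (f := code) (t := F.image code ∪ M.image code)
      (fun S hS => by
        simpa using Or.inr ⟨S, hS, rfl⟩)]
  refine Finset.sum_le_sum fun ⟨c, d⟩ _ => ?_
  simp only [code, Prod.mk.injEq]
  rcases le_total (X₁.card + 2 * d.count true) (X₂.card + 2 * c.count true) with hcd | hcd
  · exact card_filter_chain_le hd hF hl h₁ h₂ c d hcd
  · have := card_filter_chain_le hd.symm (fun S hS => by rw [Finset.union_comm]; exact hF S hS)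
      hr h₂ h₁ d c hcd
    simp only [M]
    rw [Finset.union_comm X₂ X₁] at this
    simpa only [and_comm] using this

/-! ### Systems defined by a relation between the parts -/

/-- The system of all unions of related subsets of the two parts. -/
def systemOfRel (X₁ X₂ : Finset α) (R : Finset α → Finset α → Prop) [DecidableRel R] :
    Finset (Finset α) :=
  ((X₁.powerset ×ˢ X₂.powerset).filter (fun p => R p.1 p.2)).image (fun p => p.1 ∪ p.2)

variable {R : Finset α → Finset α → Prop} [DecidableRel R]

theorem card_systemOfRel (hd : Disjoint X₁ X₂) :
    (systemOfRel X₁ X₂ R).card =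
      ((X₁.powerset ×ˢ X₂.powerset).filter (fun p => R p.1 p.2)).card := by
  refine Finset.card_image_of_injOn ?_
  rintro ⟨A, B⟩ hp ⟨A', B'⟩ hq h
  simp only [Finset.coe_filter, Finset.mem_product, Finset.mem_powerset, Set.mem_ofPred_eq]
    at hp hq h
  rw [Prod.mk.injEq]
  exact ⟨by rw [← union_inter_left hd hp.1.1 hp.1.2, h, union_inter_left hd hq.1.1 hq.1.2],
    by rw [← union_inter_right hd hp.1.1 hp.1.2, h, union_inter_right hd hq.1.1 hq.1.2]⟩

theorem mem_traceSystem_systemOfRel_left (hd : Disjoint X₁ X₂) {A B : Finset α} :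
    B ∈ traceSystem (systemOfRel X₁ X₂ R) X₁ X₂ A ↔ A ⊆ X₁ ∧ B ⊆ X₂ ∧ R A B := by
  simp only [mem_traceSystem, systemOfRel, Finset.mem_image, Finset.mem_filter,
    Finset.mem_product, Finset.mem_powerset, Prod.exists]
  constructor
  · rintro ⟨_, ⟨A', B', ⟨⟨hA, hB⟩, hR⟩, rfl⟩, rfl, rfl⟩
    rw [union_inter_left hd hA hB, union_inter_right hd hA hB]
    exact ⟨hA, hB, hR⟩
  · rintro ⟨hA, hB, hR⟩
    exact ⟨_, ⟨A, B, ⟨⟨hA, hB⟩, hR⟩, rfl⟩, union_inter_left hd hA hB, union_inter_right hd hA hB⟩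

theorem mem_traceSystem_systemOfRel_right (hd : Disjoint X₁ X₂) {A B : Finset α} :
    A ∈ traceSystem (systemOfRel X₁ X₂ R) X₂ X₁ B ↔ A ⊆ X₁ ∧ B ⊆ X₂ ∧ R A B := by
  rw [← mem_traceSystem_systemOfRel_left hd, mem_traceSystem, mem_traceSystem]
  simp only [and_comm]

/-- Equal cardinalities of related sets make the Sperner condition automatic. -/
theorem is2I2S_systemOfRel (hd : Disjoint X₁ X₂)
    (hl : ∀ A ⊆ X₁, ∀ B ⊆ X₂, ∀ B' ⊆ X₂, R A B → R A B' →
      B.card = B'.card ∧ (B ≠ B' → (B ∩ B').Nonempty))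
    (hr : ∀ B ⊆ X₂, ∀ A ⊆ X₁, ∀ A' ⊆ X₁, R A B → R A' B →
      A.card = A'.card ∧ (A ≠ A' → (A ∩ A').Nonempty)) :
    Is2I2S X₁ X₂ (systemOfRel X₁ X₂ R) := by
  refine ⟨?_, fun A hA => ⟨?_, ?_⟩, fun B hB => ⟨?_, ?_⟩⟩
  · intro S hS
    simp only [systemOfRel, Finset.mem_image, Finset.mem_filter,
      Finset.mem_product, Finset.mem_powerset, Prod.exists] at hS
    obtain ⟨A, B, ⟨⟨hA, hB⟩, _⟩, rfl⟩ := hS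
    exact Finset.union_subset_union hA hB
  · intro B hB B' hB' hne
    rw [mem_traceSystem_systemOfRel_left hd] at hB hB'
    exact (hl A hA B hB.2.1 B' hB'.2.1 hB.2.2 hB'.2.2).2 hne
  · intro B hB B' hB' hne hs
    rw [mem_traceSystem_systemOfRel_left hd] at hB hB'
    exact hne (Finset.eq_of_subset_of_card_le hs
      (hl A hA B hB.2.1 B' hB'.2.1 hB.2.2 hB'.2.2).1.ge)
  · intro A hA A' hA' hne
    rw [mem_traceSystem_systemOfRel_right hd] at hA hA'
    exact (hr B hB A hA.1 A' hA'.1 hA.2.2 hA'.2.2).2 hne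
  · intro A hA A' hA' hne hs
    rw [mem_traceSystem_systemOfRel_right hd] at hA hA'
    exact hne (Finset.eq_of_subset_of_card_le hs
      (hr B hB A hA.1 A' hA'.1 hA.2.2 hA'.2.2).1.ge)

end Traces

end TwoPart
-- Binomial coefficients near the middle
namespace TwoPart

theorem middleBinom_eq (n : ℕ) : middleBinom n = n.choose (n / 2) := by
  rw [middleBinom, ← Nat.choose_symm (by omega : n / 2 ≤ n)]
  congr 1
  omega

theorem middleBinom_pos (n : ℕ) : 0 < middleBinom n := Nat.choose_pos (by omega)

theorem choose_le_middleBinom (n k : ℕ) : n.choose k ≤ middleBinom n := by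
  rw [middleBinom_eq]
  exact Nat.choose_le_middle k n

theorem middleBinom_succ_le (n : ℕ) : middleBinom (n + 1) ≤ 2 * middleBinom n := by
  have h : middleBinom (n + 1) = n.choose (n / 2) + n.choose (n / 2 + 1) := by
    rw [middleBinom, show (n + 1 + 1) / 2 = n / 2 + 1 by omega, Nat.choose_succ_succ]
  have := choose_le_middleBinom n (n / 2)
  have := choose_le_middleBinom n (n / 2 + 1)
  omega

theorem middleBinom_add_le (a b : ℕ) : middleBinom (a + b) ≤ 2 ^ a * middleBinom b := by
  induction a with
  | zero => simp
  | succ a ih =>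
    have := middleBinom_succ_le (a + b)
    rw [show a + 1 + b = a + b + 1 by omega, pow_succ]
    calc _ ≤ 2 * middleBinom (a + b) := this
      _ ≤ 2 * (2 ^ a * middleBinom b) := by gcongr
      _ = _ := by ring

theorem middleBinom_mono : Monotone middleBinom := by
  refine monotone_nat_of_le_succ fun n => ?_
  calc middleBinom n = n.choose (n / 2) := middleBinom_eq n
    _ ≤ (n + 1).choose (n / 2 + 1) := by rw [Nat.choose_succ_succ]; omega
    _ ≤ _ := choose_le_middleBinom _ _

/-- Binomial coefficients decrease slowly near the middle. -/
theorem one_sub_mul_middleBinom_le_choose (n s : ℕ) :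
    (1 - (s : ℝ) ^ 2 / ((n / 2 : ℕ) + 1)) * middleBinom n ≤ n.choose (n / 2 + s) := by
  set m := n / 2 with hm
  have hm0 : (0 : ℝ) < (m : ℝ) + 1 := by positivity
  induction s with
  | zero => simp [middleBinom_eq, hm]
  | succ s ih =>
    have hmono : n.choose (m + s) ≤ middleBinom n := choose_le_middleBinom _ _
    have hmonoR : (n.choose (m + s) : ℝ) ≤ middleBinom n := by exact_mod_cast hmono
    -- One step away from the middle costs at most `(2s + 1)/(m + 1)` of the central coefficient;
    -- these odd numbers add up to `s ^ 2`.
    have hstep : ((m : ℝ) + 1) * n.choose (m + s) ≤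
        (m + 1) * n.choose (m + (s + 1)) + (2 * s + 1) * middleBinom n := by
      rcases le_total (n.choose (m + s)) (n.choose (m + (s + 1))) with h | h
      · have h' : (n.choose (m + s) : ℝ) ≤ n.choose (m + (s + 1)) := by exact_mod_cast h
        have : ((m : ℝ) + 1) * n.choose (m + s) ≤ (m + 1) * n.choose (m + (s + 1)) := by gcongr
        have : (0 : ℝ) ≤ (2 * s + 1) * middleBinom n := by positivity
        linarith
      · have h' : (n.choose (m + (s + 1)) : ℝ) ≤ n.choose (m + s) := by exact_mod_cast h
        have hrec : ((m : ℝ) - s) * n.choose (m + s) ≤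
            n.choose (m + (s + 1)) * (m + s + 1) := by
          have e : n.choose (m + s + 1) * (m + s + 1) = n.choose (m + s) * (n - (m + s)) :=
            Nat.choose_succ_right_eq n (m + s)
          have e' : (n.choose (m + (s + 1)) : ℝ) * (m + s + 1) =
              n.choose (m + s) * ((n - (m + s) : ℕ) : ℝ) := by exact_mod_cast e
          have hle : (m : ℝ) - s ≤ ((n - (m + s) : ℕ) : ℝ) := by
            have : m ≤ n - (m + s) + s := by omega
            have : (m : ℝ) ≤ ((n - (m + s) : ℕ) : ℝ) + s := by exact_mod_cast this
            linarith
          rw [e', mul_comm]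
          gcongr
        have h1 : (s : ℝ) * n.choose (m + (s + 1)) ≤ s * n.choose (m + s) := by gcongr
        have h2 : (2 * (s : ℝ) + 1) * n.choose (m + s) ≤ (2 * s + 1) * middleBinom n := by gcongr
        nlinarith
    have ih' : ((m : ℝ) + 1 - s ^ 2) * middleBinom n ≤ (m + 1) * n.choose (m + s) := by
      have := mul_le_mul_of_nonneg_left ih hm0.le
      calc _ = ((m : ℝ) + 1) * ((1 - (s : ℝ) ^ 2 / (m + 1)) * middleBinom n) := by field_simp
        _ ≤ _ := this
    have : ((m : ℝ) + 1 - ((s + 1 : ℕ) : ℝ) ^ 2) * middleBinom n ≤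
        (m + 1) * n.choose (m + (s + 1)) := by
      push_cast
      nlinarith
    rw [← mul_le_mul_iff_right₀ hm0]
    calc _ = ((m : ℝ) + 1 - ((s + 1 : ℕ) : ℝ) ^ 2) * middleBinom n := by field_simp
      _ ≤ _ := this

/-! ### Asymptotic sharpness for a small first part -/

/-- Such a set avoids the first `t + 1` points of the enumeration. -/
theorem card_filter_lt_sInf_le {α : Type*} {X₁ : Finset α} {f : α → ℕ} (hf : Set.InjOn f X₁)
    (hf' : X₁.image f = Finset.range X₁.card) (t : ℕ) :
    (X₁.powerset.filter (fun A : Finset α => t < sInf (f '' A))).card * 2 ^ (t + 1) ≤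
      2 ^ X₁.card := by
  have hsub : X₁.powerset.filter (fun A : Finset α => t < sInf (f '' A)) ⊆
      (X₁.filter (fun x => t < f x)).powerset := by
    intro A hA
    obtain ⟨hAX, ht⟩ := Finset.mem_filter.1 hA
    rw [Finset.mem_powerset] at hAX ⊢
    intro x hx
    exact Finset.mem_filter.2 ⟨hAX hx, ht.trans_le (Nat.sInf_le ⟨x, hx, rfl⟩)⟩
  have hcard : (X₁.filter (fun x => t < f x)).card = X₁.card - (t + 1) := by
    rw [← Finset.card_image_of_injOn (f := f)
      (hf.mono (Finset.coe_subset.2 (Finset.filter_subset _ _)))]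
    have : (X₁.filter (fun x => t < f x)).image f = Finset.Ico (t + 1) X₁.card := by
      ext y
      have hy : y ∈ X₁.image f ↔ y < X₁.card := by rw [hf', Finset.mem_range]
      simp only [Finset.mem_image, Finset.mem_filter, Finset.mem_Ico] at hy ⊢
      constructor
      · rintro ⟨x, ⟨hx, hxt⟩, rfl⟩
        exact ⟨hxt, hy.1 ⟨x, hx, rfl⟩⟩
      · rintro ⟨hty, hyc⟩
        obtain ⟨x, hx, rfl⟩ := hy.2 hyc
        exact ⟨x, ⟨hx, hty⟩, rfl⟩
    rw [this, Nat.card_Ico]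
  rcases le_or_gt (t + 1) X₁.card with h | h
  · calc _ ≤ 2 ^ (X₁.card - (t + 1)) * 2 ^ (t + 1) := by
          gcongr
          rw [← hcard, ← Finset.card_powerset]
          exact Finset.card_le_card hsub
      _ = 2 ^ X₁.card := by rw [← pow_add, Nat.sub_add_cancel h]
  -- Only the empty set could avoid every point, and it is excluded because `sInf ∅ = 0`.
  · have hempty : X₁.powerset.filter (fun A : Finset α => t < sInf (f '' A)) = ∅ := by
      rw [Finset.filter_eq_empty_iff]
      intro A hA ht
      have : A = ∅ := by
        have h0 : X₁.filter (fun x => t < f x) = ∅ :=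
          Finset.card_eq_zero.1 (by omega)
        have := hsub (Finset.mem_filter.2 ⟨hA, ht⟩)
        rwa [h0, Finset.powerset_empty, Finset.mem_singleton] at this
      subst this
      simp at ht
    simp [hempty]

section SmallPart

variable {α : Type*} [DecidableEq α] {X₁ X₂ : Finset α}

/-- Subsets of the first part are separated by their cardinality and by their least element
with respect to an enumeration `f`; each class is joined to one level of the second part. -/
def LevelRel (n₁ n₂ t : ℕ) (f : α → ℕ) (A B : Finset α) : Prop :=
  sInf (f '' A) ≤ t ∧ B.card = n₂ / 2 + (1 + (A.card + (n₁ + 1) * sInf (f '' A)))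

theorem inter_nonempty_of_sInf_eq {f : α → ℕ} (hf : Set.InjOn f X₁) {A A' : Finset α}
    (hA : A ⊆ X₁) (hA' : A' ⊆ X₁) (hc : A.card = A'.card)
    (h : sInf (f '' A) = sInf (f '' A')) (hne : A ≠ A') : (A ∩ A').Nonempty := by
  have hn : A.Nonempty := by
    rw [Finset.nonempty_iff_ne_empty]
    rintro rfl
    exact hne (Finset.card_eq_zero.1 (by simpa using hc.symm)).symm
  have hn' : A'.Nonempty := by rw [← Finset.card_pos, ← hc, Finset.card_pos]; exact hn
  obtain ⟨x, hx, hxe⟩ := Nat.sInf_mem ((Finset.coe_nonempty.2 hn).image f)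
  obtain ⟨y, hy, hye⟩ := Nat.sInf_mem ((Finset.coe_nonempty.2 hn').image f)
  have : x = y := hf (hA hx) (hA' hy) (by rw [hxe, hye, h])
  subst this
  exact ⟨x, Finset.mem_inter.2 ⟨hx, hy⟩⟩

theorem inter_nonempty_of_card_lt {B B' X : Finset α} (hB : B ⊆ X) (hB' : B' ⊆ X)
    (h : X.card < B.card + B'.card) : (B ∩ B').Nonempty := by
  rw [← Finset.card_pos]
  have := Finset.card_union_add_card_inter B B'
  have := Finset.card_le_card (Finset.union_subset hB hB')
  omega

open Classical in
theorem is2I2S_levelRel (hd : Disjoint X₁ X₂) (t : ℕ) {f : α → ℕ} (hf : Set.InjOn f X₁) :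
    Is2I2S X₁ X₂ (systemOfRel X₁ X₂ (LevelRel X₁.card X₂.card t f)) := by
  refine is2I2S_systemOfRel hd ?_ ?_
  · rintro A - B hB B' hB' ⟨-, h⟩ ⟨-, h'⟩
    exact ⟨h.trans h'.symm, fun _ => inter_nonempty_of_card_lt hB hB' (by omega)⟩
  · rintro B - A hA A' hA' ⟨-, h⟩ ⟨-, h'⟩
    have e : A.card + (X₁.card + 1) * sInf (f '' A) =
        A'.card + (X₁.card + 1) * sInf (f '' A') := by omega
    -- `A.card` is at most `|X₁|`, so it is the last digit in base `|X₁| + 1`: the level determines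
    -- both cardinality and least element.
    have l := Nat.lt_succ_of_le (Finset.card_le_card hA)
    have l' := Nat.lt_succ_of_le (Finset.card_le_card hA')
    have e1 : A.card = A'.card := by
      have := congrArg (· % (X₁.card + 1)) e
      simpa [Nat.add_mul_mod_self_left, Nat.mod_eq_of_lt l, Nat.mod_eq_of_lt l'] using this
    have e2 : sInf (f '' A) = sInf (f '' A') :=
      Nat.eq_of_mul_eq_mul_left (Nat.succ_pos X₁.card) (by rw [e1] at e; exact Nat.add_left_cancel e)
    exact ⟨e1, inter_nonempty_of_sInf_eq hf hA hA' e1 e2⟩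

theorem exists_enumeration (X : Finset α) :
    ∃ f : α → ℕ, Set.InjOn f X ∧ X.image f = Finset.range X.card := by
  refine ⟨fun x => if h : x ∈ X then X.equivFin ⟨x, h⟩ else 0, ?_, ?_⟩
  · intro x hx y hy h
    have hx' : x ∈ X := hx
    have hy' : y ∈ X := hy
    simp only [hx', hy', dif_pos] at h
    simpa using X.equivFin.injective (Fin.ext h)
  · ext k
    simp only [Finset.mem_image, Finset.mem_range]
    constructor
    · rintro ⟨x, hx, rfl⟩
      simp [hx]
    · intro hk
      refine ⟨X.equivFin.symm ⟨k, hk⟩, Finset.coe_mem _, ?_⟩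
      simp

/-- Each `A` with least element at most `t` is joined to a whole level of `X₂` at distance at most
`(|X₁| + 1)(t + 1)` above the middle. The count is compared with the middle binomial of the union
through `middleBinom_add_le`. -/
theorem exists_is2I2S_of_small_part (hd : Disjoint X₁ X₂) (t : ℕ) :
    ∃ F, Is2I2S X₁ X₂ F ∧
      (1 - (1 / 2 : ℝ) ^ (t + 1)) *
        ((1 - (((X₁.card + 1) * (t + 1) : ℕ) : ℝ) ^ 2 / ((X₂.card / 2 : ℕ) + 1)) *
          middleBinom (X₁ ∪ X₂).card) ≤ F.card := by
  classical
  obtain ⟨f, hf, hf'⟩ := exists_enumeration X₁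
  refine ⟨_, is2I2S_levelRel hd t hf, ?_⟩
  set n₁ := X₁.card
  set n₂ := X₂.card
  set L : ℝ := 1 - (((n₁ + 1) * (t + 1) : ℕ) : ℝ) ^ 2 / ((n₂ / 2 : ℕ) + 1) with hL
  set good := X₁.powerset.filter (fun A : Finset α => sInf (f '' A) ≤ t) with hgood
  have hpow : (1 / 2 : ℝ) ^ (t + 1) ≤ 1 := pow_le_one₀ (by norm_num) (by norm_num)
  rcases le_or_gt L 0 with hL0 | hL0
  · refine le_trans ?_ (Nat.cast_nonneg _)
    exact mul_nonpos_of_nonneg_of_nonpos (by linarith)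
      (mul_nonpos_of_nonpos_of_nonneg hL0 (Nat.cast_nonneg _))
  have hcount : (good.card : ℝ) * (L * middleBinom n₂) ≤
      (systemOfRel X₁ X₂ (LevelRel n₁ n₂ t f)).card := by
    rw [card_systemOfRel hd, Finset.card_eq_sum_card_fiberwise (f := Prod.fst) (t := X₁.powerset)
      (fun p hp => (Finset.mem_product.1 (Finset.mem_filter.1 hp).1).1)]
    rw [← nsmul_eq_mul]
    push_cast
    refine (Finset.card_nsmul_le_sum good _ _ fun A hA => ?_).trans
      (Finset.sum_le_sum_of_subset_of_nonneg (Finset.filter_subset _ _) fun _ _ _ =>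
        Nat.cast_nonneg _)
    obtain ⟨hAX, hAt⟩ := Finset.mem_filter.1 hA
    set s := 1 + (A.card + (n₁ + 1) * sInf (f '' A)) with hs
    have hfib : n₂.choose (n₂ / 2 + s) ≤ (((X₁.powerset ×ˢ X₂.powerset).filter
        (fun p => LevelRel n₁ n₂ t f p.1 p.2)).filter (fun p => p.1 = A)).card := by
      rw [← Finset.card_powersetCard]
      refine Finset.card_le_card_of_injOn (fun B => (A, B)) ?_
        (fun B _ B' _ h => (Prod.mk.inj h).2)
      intro B hB
      obtain ⟨hBX, hBc⟩ := Finset.mem_powersetCard.1 (Finset.mem_coe.1 hB)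
      simp only [Finset.coe_filter, Finset.mem_filter, Finset.mem_product, Set.mem_ofPred_eq,
        and_true]
      exact ⟨⟨hAX, Finset.mem_powerset.2 hBX⟩, hAt, hBc⟩
    have hsle : s ≤ (n₁ + 1) * (t + 1) := by
      have h1 : A.card ≤ n₁ := Finset.card_le_card (Finset.mem_powerset.1 hAX)
      have h2 : (n₁ + 1) * sInf (f '' A) ≤ (n₁ + 1) * t := Nat.mul_le_mul_left _ hAt
      rw [Nat.mul_succ]
      omega
    calc L * middleBinom n₂ ≤ (1 - (s : ℝ) ^ 2 / ((n₂ / 2 : ℕ) + 1)) * middleBinom n₂ := by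
          rw [hL]
          gcongr
      _ ≤ n₂.choose (n₂ / 2 + s) := one_sub_mul_middleBinom_le_choose _ _
      _ ≤ _ := by exact_mod_cast hfib
  have hgoodcard : (1 - (1 / 2 : ℝ) ^ (t + 1)) * 2 ^ n₁ ≤ good.card := by
    have h1 := card_filter_lt_sInf_le hf hf' t
    have h2 := Finset.card_filter_add_card_filter_not (s := X₁.powerset)
      (fun A : Finset α => sInf (f '' A) ≤ t)
    simp only [not_le, Finset.card_powerset] at h2
    have h1' : ((X₁.powerset.filter (fun A : Finset α => t < sInf (f '' A))).card : ℝ) *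
        2 ^ (t + 1) ≤ 2 ^ n₁ := by exact_mod_cast h1
    have h2' : (good.card : ℝ) +
        (X₁.powerset.filter (fun A : Finset α => t < sInf (f '' A))).card = 2 ^ n₁ := by
      have := congrArg (Nat.cast (R := ℝ)) h2
      rwa [Nat.cast_add, Nat.cast_pow, Nat.cast_ofNat] at this
    have h3 : ((X₁.powerset.filter (fun A : Finset α => t < sInf (f '' A))).card : ℝ) ≤
        (1 / 2) ^ (t + 1) * 2 ^ n₁ := by
      rw [one_div, inv_pow, inv_mul_eq_div, le_div_iff₀ (by positivity)]
      exact h1'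
    linarith
  have hM : (middleBinom (X₁ ∪ X₂).card : ℝ) ≤ 2 ^ n₁ * middleBinom n₂ := by
    rw [Finset.card_union_of_disjoint hd]
    exact_mod_cast middleBinom_add_le n₁ n₂
  calc (1 - (1 / 2 : ℝ) ^ (t + 1)) * (L * middleBinom (X₁ ∪ X₂).card)
      ≤ (1 - (1 / 2 : ℝ) ^ (t + 1)) * (L * (2 ^ n₁ * middleBinom n₂)) := by
        have : 0 ≤ 1 - (1 / 2 : ℝ) ^ (t + 1) := by linarith
        gcongr
    _ = ((1 - (1 / 2 : ℝ) ^ (t + 1)) * 2 ^ n₁) * (L * middleBinom n₂) := by ring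
    _ ≤ good.card * (L * middleBinom n₂) := by gcongr
    _ ≤ _ := hcount

/-- Taking largest systems lets `t` stay fixed while `k → ∞`, with no diagonal choice of `t`. -/
theorem exists_is2I2S_card_max (X₁ X₂ : Finset α) :
    ∃ F, Is2I2S X₁ X₂ F ∧ ∀ G, Is2I2S X₁ X₂ G → G.card ≤ F.card := by
  classical
  have hempty : Is2I2S X₁ X₂ ∅ := by
    refine ⟨by simp, fun A _ => ?_, fun B _ => ?_⟩ <;>
      simp [IsIntersecting, IsSperner, traceSystem]
  obtain ⟨F, hF, hmax⟩ := Finset.exists_max_image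
    ((X₁ ∪ X₂).powerset.powerset.filter (Is2I2S X₁ X₂)) Finset.card
    ⟨∅, by simpa using hempty⟩
  refine ⟨F, (Finset.mem_filter.1 hF).2, fun G hG => hmax G ?_⟩
  rw [Finset.mem_filter, Finset.mem_powerset]
  exact ⟨fun S hS => Finset.mem_powerset.2 (hG.subset S hS), hG⟩

end SmallPart

/-- Eventually `a ^ 2 ≤ b`, hence `a ≤ b`, so `b → ∞` and the added `1` is also `o(√b)`. -/
theorem tendsto_card_add_one_sq_div {a b : ℕ → ℕ}
    (hn : Tendsto (fun k => a k + b k) atTop atTop)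
    (h : (fun k => (a k : ℝ)) =o[atTop] (fun k => Real.sqrt (b k : ℝ))) :
    Tendsto (fun k => ((a k : ℝ) + 1) ^ 2 / ((b k / 2 : ℕ) + 1)) atTop (𝓝 0) := by
  have hb : Tendsto b atTop atTop := by
    have hab : ∀ᶠ k in atTop, a k + b k ≤ 2 * b k := by
      filter_upwards [h.bound one_pos] with k hk
      rw [Real.norm_natCast, one_mul, Real.norm_of_nonneg (Real.sqrt_nonneg _),
        Real.le_sqrt (Nat.cast_nonneg _) (Nat.cast_nonneg _)] at hk
      have : a k ^ 2 ≤ b k := by exact_mod_cast hk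
      nlinarith
    refine tendsto_atTop.2 fun N => ?_
    filter_upwards [hab, tendsto_atTop.1 hn (2 * N)] with k h1 h2
    omega
  have hbR : Tendsto (fun k => (b k : ℝ)) atTop atTop := tendsto_natCast_atTop_atTop.comp hb
  have hone : (fun _ : ℕ => (1 : ℝ)) =o[atTop] (fun k => Real.sqrt (b k : ℝ)) := by
    rw [isLittleO_const_left]
    right
    exact tendsto_norm_atTop_atTop.comp (Real.tendsto_sqrt_atTop.comp hbR)
  have h2 := (h.add hone).pow (n := 2) (by norm_num)
  have h3 : (fun k => ((a k : ℝ) + 1) ^ 2) =o[atTop] (fun k => (((b k / 2 : ℕ) : ℝ) + 1)) := by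
    refine h2.trans_isBigO (IsBigO.of_bound 2 (Eventually.of_forall fun k => ?_))
    rw [Real.sq_sqrt (Nat.cast_nonneg _), Real.norm_natCast, Real.norm_of_nonneg (by positivity)]
    have : b k ≤ 2 * (b k / 2 + 1) := by omega
    exact_mod_cast this
  exact h3.tendsto_div_nhds_zero

theorem exists_tendsto_card_div_middleBinom {α : Type*} [DecidableEq α] (X₁ X₂ : ℕ → Finset α)
    (hd : ∀ k, Disjoint (X₁ k) (X₂ k))
    (hn : Tendsto (fun k => (X₁ k ∪ X₂ k).card) atTop atTop)
    (h : (fun k => ((X₁ k).card : ℝ)) =o[atTop] (fun k => Real.sqrt ((X₂ k).card : ℝ))) :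
    ∃ F : ℕ → Finset (Finset α), (∀ k, Is2I2S (X₁ k) (X₂ k) (F k)) ∧
      Tendsto (fun k => ((F k).card : ℝ) / (middleBinom (X₁ k ∪ X₂ k).card : ℝ))
        atTop (𝓝 1) := by
  choose F hF hmax using fun k => exists_is2I2S_card_max (X₁ k) (X₂ k)
  refine ⟨F, hF, ?_⟩
  have hpos : ∀ k, (0 : ℝ) < middleBinom (X₁ k ∪ X₂ k).card := fun k => by
    exact_mod_cast middleBinom_pos _
  have hlim := tendsto_card_add_one_sq_div
    (by simpa only [Finset.card_union_of_disjoint (hd _)] using hn) h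
  refine tendsto_order.2 ⟨fun c hc => ?_, fun c hc => Eventually.of_forall fun k => ?_⟩
  · have ht : ∃ t : ℕ, c < 1 - (1 / 2 : ℝ) ^ (t + 1) := by
      obtain ⟨t, ht⟩ := exists_pow_lt_of_lt_one (sub_pos.2 hc) (by norm_num : (1 / 2 : ℝ) < 1)
      refine ⟨t, ?_⟩
      have : (1 / 2 : ℝ) ^ (t + 1) ≤ (1 / 2) ^ t :=
        pow_le_pow_of_le_one (by norm_num) (by norm_num) (Nat.le_succ t)
      linarith
    obtain ⟨t, ht⟩ := ht
    have hlim2 : Tendsto (fun k => (1 - (1 / 2 : ℝ) ^ (t + 1)) * (1 - ((t : ℝ) + 1) ^ 2 *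
        ((((X₁ k).card : ℝ) + 1) ^ 2 / (((X₂ k).card / 2 : ℕ) + 1)))) atTop
        (𝓝 (1 - (1 / 2 : ℝ) ^ (t + 1))) := by
      have := ((hlim.const_mul (((t : ℝ) + 1) ^ 2)).const_sub 1).const_mul
        (1 - (1 / 2 : ℝ) ^ (t + 1))
      simpa using this
    filter_upwards [hlim2.eventually_const_lt ht] with k hk
    obtain ⟨G, hG, hGc⟩ := exists_is2I2S_of_small_part (hd k) t
    rw [lt_div_iff₀ (hpos k)]
    have hGF : (G.card : ℝ) ≤ (F k).card := by exact_mod_cast hmax k G hG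
    refine lt_of_lt_of_le (mul_lt_mul_of_pos_right hk (hpos k)) (le_trans (le_of_eq ?_)
      (hGc.trans hGF))
    push_cast
    ring
  · refine lt_of_le_of_lt ?_ hc
    rw [div_le_one (hpos k)]
    exact_mod_cast card_le_middleBinom_of_sperner (hd k) (hF k).subset
      (fun A hA => ((hF k).left A hA).2) (fun B hB => ((hF k).right B hB).2)

end TwoPart
-- Parts of equal size
namespace TwoPart

/-- A set of pairs of nonempty subsets of a three-element set in which every row and every
column consists of pairwise intersecting sets. It has 22 members, more than one third of
the `64` pairs. -/
def typePairs : Finset (Finset (Fin 3) × Finset (Fin 3)) :=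
  {({0}, {1}), ({0}, {0, 1}),
    ({1}, {0}), ({1}, {0, 2}), ({1}, {0, 1, 2}),
    ({0, 1}, {0}), ({0, 1}, {0, 1}), ({0, 1}, {0, 2}), ({0, 1}, {0, 1, 2}),
    ({2}, {2}), ({2}, {1, 2}),
    ({0, 2}, {1}), ({0, 2}, {0, 1}), ({0, 2}, {1, 2}),
    ({1, 2}, {2}), ({1, 2}, {0, 2}), ({1, 2}, {1, 2}), ({1, 2}, {0, 1, 2}),
    ({0, 1, 2}, {2}), ({0, 1, 2}, {0, 2}), ({0, 1, 2}, {1, 2}), ({0, 1, 2}, {0, 1, 2})}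

theorem card_typePairs : typePairs.card = 22 := by decide

set_option maxRecDepth 10000 in
theorem typePairs_left : ∀ p ∈ typePairs, ∀ q ∈ typePairs, p.1 = q.1 → (p.2 ∩ q.2).Nonempty := by
  decide

set_option maxRecDepth 10000 in
theorem typePairs_right : ∀ p ∈ typePairs, ∀ q ∈ typePairs, p.2 = q.2 → (p.1 ∩ q.1).Nonempty := by
  decide

/-- `j` lies between `k` and its mirror image `n - k`, so unimodality and symmetry apply. -/
theorem choose_le_choose_of_le_of_add_le {n k j : ℕ} (hkj : k ≤ j) (h : j + k ≤ n) :
    n.choose k ≤ n.choose j := by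
  have mono : ∀ i, k ≤ i → 2 * i ≤ n → n.choose k ≤ n.choose i := by
    intro i hi
    induction i, hi using Nat.le_induction with
    | base => exact fun _ => le_rfl
    | succ i _ ih =>
      exact fun h2 => (ih (by omega)).trans (Nat.choose_le_succ_of_lt_half_left (by omega))
  rcases le_total (2 * j) n with h2 | h2
  · exact mono j hkj h2
  · rw [← Nat.choose_symm (by omega : j ≤ n)]
    exact mono _ (by omega) (by omega)

theorem sum_range_choose_sq (n : ℕ) :
    ∑ i ∈ Finset.range (n + 1), n.choose i ^ 2 = middleBinom (2 * n) := by
  rw [Nat.sum_range_choose_sq, middleBinom_eq, Nat.mul_div_cancel_left _ two_pos]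

/-- The sum of squares is symmetric about `n / 2`, and a window of at most `2d + 1` central terms
covers what the two tails miss. -/
theorem middleBinom_two_mul_le (n d : ℕ) :
    middleBinom (2 * n) ≤
      2 * ∑ k ∈ (Finset.range (n + 1)).filter (fun k => 2 * k + d ≤ n), n.choose k ^ 2 +
        (2 * d + 1) * middleBinom n ^ 2 := by
  set low := (Finset.range (n + 1)).filter (fun k => 2 * k + d ≤ n) with hlow
  set high := (Finset.range (n + 1)).filter (fun k => n + d ≤ 2 * k)
  set mid := Finset.Icc (n / 2 - d) (n / 2 + d)
  have hhigh : ∑ k ∈ high, n.choose k ^ 2 = ∑ k ∈ low, n.choose k ^ 2 := by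
    refine Finset.sum_nbij' (n - ·) (n - ·) ?_ ?_ ?_ ?_ ?_
    · intro k hk; simp only [high, low, Finset.mem_filter, Finset.mem_range] at hk ⊢; omega
    · intro k hk; simp only [high, low, Finset.mem_filter, Finset.mem_range] at hk ⊢; omega
    · intro k hk; simp only [high, Finset.mem_filter, Finset.mem_range] at hk ⊢; omega
    · intro k hk; simp only [low, Finset.mem_filter, Finset.mem_range] at hk ⊢; omega
    · intro k hk
      simp only [high, Finset.mem_filter, Finset.mem_range] at hk
      rw [Nat.choose_symm (by omega)]
  have hmid : ∑ k ∈ mid, n.choose k ^ 2 ≤ (2 * d + 1) * middleBinom n ^ 2 := by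
    refine (Finset.sum_le_card_nsmul mid _ (middleBinom n ^ 2) fun k _ =>
      Nat.pow_le_pow_left (choose_le_middleBinom n k) 2).trans ?_
    rw [smul_eq_mul, Nat.card_Icc]
    gcongr
    omega
  have hcover : Finset.range (n + 1) ⊆ low ∪ high ∪ mid := by
    intro k hk
    simp only [low, high, mid, Finset.mem_union, Finset.mem_filter, Finset.mem_Icc,
      Finset.mem_range] at hk ⊢
    omega
  have h1 := Finset.sum_le_sum_of_subset (f := fun k => n.choose k ^ 2) hcover
  have h2 := Finset.sum_union_inter (s₁ := low ∪ high) (s₂ := mid) (f := fun k => n.choose k ^ 2)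
  have h3 := Finset.sum_union_inter (s₁ := low) (s₂ := high) (f := fun k => n.choose k ^ 2)
  rw [sum_range_choose_sq] at h1
  omega

/-- Makes the central window negligible: each of the `K` levels from the middle upwards has at least
half the central size, and their squares are part of the sum for `C(2n, n)`. -/
theorem mul_middleBinom_sq_le {n K : ℕ} (hn : 4 * K ^ 2 ≤ n) :
    K * middleBinom n ^ 2 ≤ 4 * middleBinom (2 * n) := by
  have hlevel : ∀ s ∈ Finset.range K, (middleBinom n) ^ 2 ≤ 4 * n.choose (n / 2 + s) ^ 2 := by
    intro s hs
    have hsK := Finset.mem_range.1 hs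
    have h := one_sub_mul_middleBinom_le_choose n s
    have hs2 : 2 * s ^ 2 ≤ n / 2 + 1 := by
      have : s ^ 2 ≤ K ^ 2 := Nat.pow_le_pow_left hsK.le 2
      omega
    have hs2' : 2 * (s : ℝ) ^ 2 ≤ (n / 2 : ℕ) + 1 := by exact_mod_cast hs2
    have hfrac : (s : ℝ) ^ 2 / ((n / 2 : ℕ) + 1) ≤ 1 / 2 := by
      rw [div_le_div_iff₀ (by positivity) two_pos]
      linarith
    have hM : (0 : ℝ) ≤ middleBinom n := Nat.cast_nonneg _
    have h2 : (middleBinom n : ℝ) ≤ 2 * n.choose (n / 2 + s) := by nlinarith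
    have h3 : middleBinom n ≤ 2 * n.choose (n / 2 + s) := by exact_mod_cast h2
    calc _ ≤ (2 * n.choose (n / 2 + s)) ^ 2 := Nat.pow_le_pow_left h3 2
      _ = _ := by ring
  have h1 := Finset.card_nsmul_le_sum _ _ _ hlevel
  rw [Finset.card_range, smul_eq_mul, ← Finset.mul_sum] at h1
  refine h1.trans (Nat.mul_le_mul_left 4 ?_)
  rw [← sum_range_choose_sq, ← Finset.sum_image (g := fun s => n / 2 + s)
    (f := fun k => n.choose k ^ 2) (fun _ _ _ _ h => Nat.add_left_cancel h)]
  refine Finset.sum_le_sum_of_subset fun k hk => ?_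
  obtain ⟨s, hs, rfl⟩ := Finset.mem_image.1 hk
  have := Finset.mem_range.1 hs
  have : K ≤ K ^ 2 := Nat.le_self_pow (by norm_num) K
  rw [Finset.mem_range]
  omega

theorem exists_injective_fin_three {α : Type*} {X : Finset α} (h : 3 ≤ X.card) :
    ∃ τ : Fin 3 → α, Function.Injective τ ∧ ∀ i, τ i ∈ X := by
  refine ⟨fun i => X.equivFin.symm (Fin.castLE h i), ?_, fun i => Finset.coe_mem _⟩
  exact Subtype.val_injective.comp (X.equivFin.symm.injective.comp (Fin.castLE_injective h))

theorem sum_card_fiberwise_le_card {ι κ : Type*} [DecidableEq κ] {s : Finset ι} {t : Finset κ}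
    {f : ι → κ} : ∑ j ∈ t, (s.filter (fun i => f i = j)).card ≤ s.card := by
  rw [Finset.sum_card_fiberwise_eq_card_filter]
  exact Finset.card_filter_le _ _

section EqualParts

variable {α : Type*} [DecidableEq α] {X X₁ X₂ : Finset α}

/-- The trace of a set on three given points. -/
def traceType (τ : Fin 3 → α) (A : Finset α) : Finset (Fin 3) :=
  Finset.univ.filter (fun i => τ i ∈ A)

theorem inter_nonempty_of_traceType {τ : Fin 3 → α} {A A' : Finset α}
    (h : (traceType τ A ∩ traceType τ A').Nonempty) : (A ∩ A').Nonempty := by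
  obtain ⟨i, hi⟩ := h
  simp only [traceType, Finset.mem_inter, Finset.mem_filter, Finset.mem_univ, true_and] at hi
  exact ⟨τ i, Finset.mem_inter.2 hi⟩

/-- Sets of the same size are related if they are large or if their traces form one of the
pairs in `typePairs`. -/
def TypeRel (n : ℕ) (τ₁ τ₂ : Fin 3 → α) (A B : Finset α) : Prop :=
  A.card = B.card ∧ (n < 2 * A.card ∨ (traceType τ₁ A, traceType τ₂ B) ∈ typePairs)

instance (n : ℕ) (τ₁ τ₂ : Fin 3 → α) : DecidableRel (TypeRel n τ₁ τ₂) := fun _ _ =>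
  inferInstanceAs (Decidable (_ ∧ _))

theorem is2I2S_typeRel (hd : Disjoint X₁ X₂) (hc : X₁.card = X₂.card) (τ₁ τ₂ : Fin 3 → α) :
    Is2I2S X₁ X₂ (systemOfRel X₁ X₂ (TypeRel X₁.card τ₁ τ₂)) := by
  refine is2I2S_systemOfRel hd ?_ ?_
  · rintro A - B hB B' hB' ⟨h, h1⟩ ⟨h', h1'⟩
    refine ⟨h.symm.trans h', fun _ => ?_⟩
    rcases h1 with h1 | h1
    · exact inter_nonempty_of_card_lt hB hB' (by omega)
    · rcases h1' with h1' | h1'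
      · exact inter_nonempty_of_card_lt hB hB' (by omega)
      · exact inter_nonempty_of_traceType (typePairs_left _ h1 _ h1' rfl)
  · rintro B - A hA A' hA' ⟨h, h1⟩ ⟨h', h1'⟩
    refine ⟨h.trans h'.symm, fun _ => ?_⟩
    rcases h1 with h1 | h1
    · exact inter_nonempty_of_card_lt hA hA' (by omega)
    · rcases h1' with h1' | h1'
      · exact inter_nonempty_of_card_lt hA hA' (by omega)
      · exact inter_nonempty_of_traceType (typePairs_right _ h1 _ h1' rfl)

/-- Away from the marked points the set is free, and it has `r - a.card` elements there. -/
theorem choose_le_card_traceType {τ : Fin 3 → α} (hτ : Function.Injective τ)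
    (hX : ∀ i, τ i ∈ X) (a : Finset (Fin 3)) {r : ℕ} (hr : a.card ≤ r) :
    (X.card - 3).choose (r - a.card) ≤
      ((X.powersetCard r).filter (fun A => traceType τ A = a)).card := by
  set T := Finset.univ.image τ with hT
  have hTX : T ⊆ X := by
    intro x hx
    obtain ⟨i, -, rfl⟩ := Finset.mem_image.1 hx
    exact hX i
  have hTc : T.card = 3 := by rw [hT, Finset.card_image_of_injective _ hτ]; simp
  have hXT : (X \ T).card = X.card - 3 := by rw [Finset.card_sdiff_of_subset hTX, hTc]
  have hτT : ∀ i, τ i ∈ T := fun i => Finset.mem_image_of_mem _ (Finset.mem_univ i)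
  rw [← hXT, ← Finset.card_powersetCard]
  have haT : a.image τ ⊆ T := Finset.image_subset_image (Finset.subset_univ a)
  have hdisj : ∀ S ⊆ X \ T, Disjoint S (a.image τ) := fun S hS =>
    Finset.disjoint_of_subset_left hS (Finset.disjoint_of_subset_right haT Finset.sdiff_disjoint)
  refine Finset.card_le_card_of_injOn (fun S => S ∪ a.image τ) ?_ ?_
  · intro S hS
    obtain ⟨hSX, hSc⟩ := Finset.mem_powersetCard.1 (Finset.mem_coe.1 hS)
    rw [Finset.mem_coe, Finset.mem_filter, Finset.mem_powersetCard]
    refine ⟨⟨Finset.union_subset (hSX.trans Finset.sdiff_subset) (haT.trans hTX), ?_⟩, ?_⟩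
    · rw [Finset.card_union_of_disjoint (hdisj S hSX), hSc, Finset.card_image_of_injective _ hτ]
      omega
    · ext i
      have hi : τ i ∉ S := fun h => (Finset.mem_sdiff.1 (hSX h)).2 (hτT i)
      simp [traceType, hi, hτ.eq_iff]
  · intro S hS S' hS' h
    have hSX := (Finset.mem_powersetCard.1 (Finset.mem_coe.1 hS)).1
    have hSX' := (Finset.mem_powersetCard.1 (Finset.mem_coe.1 hS')).1
    rw [← Finset.union_sdiff_cancel_right (hdisj S hSX),
      ← Finset.union_sdiff_cancel_right (hdisj S' hSX')]
    exact congrArg (· \ a.image τ) h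

theorem sum_le_card_typeRel_high (hc : X₁.card = X₂.card) (τ₁ τ₂ : Fin 3 → α) :
    ∑ k ∈ (Finset.range (X₁.card + 1)).filter (fun k => 2 * k + 1 ≤ X₁.card),
        X₁.card.choose k ^ 2 ≤
      ((X₁.powerset ×ˢ X₂.powerset).filter
        (fun p => TypeRel X₁.card τ₁ τ₂ p.1 p.2 ∧ X₁.card < 2 * p.1.card)).card := by
  refine le_trans ?_ (sum_card_fiberwise_le_card (f := fun p => X₁.card - p.1.card)
    (t := (Finset.range (X₁.card + 1)).filter (fun k => 2 * k + 1 ≤ X₁.card)))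
  refine Finset.sum_le_sum fun k hk => ?_
  simp only [Finset.mem_filter, Finset.mem_range] at hk
  calc X₁.card.choose k ^ 2
      = (X₁.powersetCard (X₁.card - k) ×ˢ X₂.powersetCard (X₁.card - k)).card := by
        rw [Finset.card_product, Finset.card_powersetCard, Finset.card_powersetCard, ← hc,
          Nat.choose_symm (by omega), sq]
    _ ≤ _ := Finset.card_le_card ?_
  rintro ⟨A, B⟩ h
  simp only [Finset.mem_product, Finset.mem_powersetCard, Finset.mem_filter,
    Finset.mem_powerset] at h ⊢
  obtain ⟨⟨hA, hAc⟩, hB, hBc⟩ := h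
  refine ⟨⟨⟨hA, hB⟩, ⟨by omega, Or.inl (by omega)⟩, by omega⟩, by omega⟩

theorem sum_le_card_typeRel_low (hc : X₁.card = X₂.card) {m : ℕ} (hm : X₁.card = m + 3)
    {τ₁ τ₂ : Fin 3 → α} (h₁ : Function.Injective τ₁) (h₂ : Function.Injective τ₂)
    (hX₁ : ∀ i, τ₁ i ∈ X₁) (hX₂ : ∀ i, τ₂ i ∈ X₂) :
    22 * ∑ k ∈ (Finset.range (m + 1)).filter (fun k => 2 * k + 3 ≤ m), m.choose k ^ 2 ≤
      ((X₁.powerset ×ˢ X₂.powerset).filter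
        (fun p => TypeRel X₁.card τ₁ τ₂ p.1 p.2 ∧ ¬ X₁.card < 2 * p.1.card)).card := by
  refine le_trans ?_ (sum_card_fiberwise_le_card
    (f := fun p => (p.1.card - 3, (traceType τ₁ p.1, traceType τ₂ p.2)))
    (t := (Finset.range (m + 1)).filter (fun k => 2 * k + 3 ≤ m) ×ˢ typePairs))
  rw [Finset.sum_product, Finset.mul_sum]
  refine Finset.sum_le_sum fun k hk => ?_
  simp only [Finset.mem_filter, Finset.mem_range] at hk
  rw [← card_typePairs, ← smul_eq_mul]
  refine Finset.card_nsmul_le_sum _ _ _ fun p hp => ?_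
  -- Makes the count uniform over trace types: `2k + 3 ≤ m` keeps `k + 3 - a.card` between `k` and
  -- `m - k`.
  have hlevel : ∀ a : Finset (Fin 3), m.choose k ≤ m.choose (k + 3 - a.card) := fun a => by
    have : a.card ≤ 3 := by simpa using Finset.card_le_univ a
    exact choose_le_choose_of_le_of_add_le (by omega) (by omega)
  have hle : ∀ a : Finset (Fin 3), a.card ≤ k + 3 := fun a => by
    have : a.card ≤ 3 := by simpa using Finset.card_le_univ a
    omega
  have e₁ := (hlevel p.1).trans
    (by simpa [hm] using choose_le_card_traceType h₁ hX₁ p.1 (hle p.1))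
  have e₂ := (hlevel p.2).trans
    (by simpa [← hc, hm] using choose_le_card_traceType h₂ hX₂ p.2 (hle p.2))
  calc m.choose k ^ 2
      ≤ (((X₁.powersetCard (k + 3)).filter (fun A => traceType τ₁ A = p.1)) ×ˢ
          ((X₂.powersetCard (k + 3)).filter (fun B => traceType τ₂ B = p.2))).card := by
        rw [Finset.card_product, sq]
        exact Nat.mul_le_mul e₁ e₂
    _ ≤ _ := Finset.card_le_card ?_
  rintro ⟨A, B⟩ h
  simp only [Finset.mem_product, Finset.mem_powersetCard, Finset.mem_filter,
    Finset.mem_powerset] at h ⊢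
  obtain ⟨⟨⟨hA, hAc⟩, hAt⟩, ⟨hB, hBc⟩, hBt⟩ := h
  refine ⟨⟨⟨hA, hB⟩, ⟨by omega, Or.inr (by rw [hAt, hBt]; exact hp)⟩, by omega⟩, ?_⟩
  rw [hAt, hBt, hAc]
  rfl

theorem exists_is2I2S_of_card_eq (hd : Disjoint X₁ X₂) (hc : X₁.card = X₂.card)
    {K : ℕ} (hK0 : 3 ≤ K) (hK : 4 * K ^ 2 ≤ X₁.card) :
    ∃ F, Is2I2S X₁ X₂ F ∧
      86 * K * middleBinom (X₁ ∪ X₂).card ≤ 128 * K * F.card + 40192 * middleBinom (X₁ ∪ X₂).card := by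
  have h3 : 3 ≤ X₁.card := by nlinarith
  obtain ⟨τ₁, h₁, hX₁⟩ := exists_injective_fin_three h3
  obtain ⟨τ₂, h₂, hX₂⟩ := exists_injective_fin_three (hc ▸ h3)
  refine ⟨_, is2I2S_typeRel hd hc τ₁ τ₂, ?_⟩
  obtain ⟨m, hm⟩ := Nat.exists_eq_add_of_le' h3
  have hu : (X₁ ∪ X₂).card = 2 * X₁.card := by
    rw [Finset.card_union_of_disjoint hd, ← hc, two_mul]
  rw [card_systemOfRel hd, hu]
  have hsplit := Finset.card_filter_add_card_filter_not
    (s := (X₁.powerset ×ˢ X₂.powerset).filter (fun p => TypeRel X₁.card τ₁ τ₂ p.1 p.2))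
    (fun p => X₁.card < 2 * p.1.card)
  rw [Finset.filter_filter, Finset.filter_filter] at hsplit
  have hhigh := sum_le_card_typeRel_high hc τ₁ τ₂
  have hlow := sum_le_card_typeRel_low hc hm h₁ h₂ hX₁ hX₂
  have b1 := middleBinom_two_mul_le X₁.card 1
  have b2 := middleBinom_two_mul_le m 3
  have b3 := mul_middleBinom_sq_le hK
  have b4 : middleBinom (2 * X₁.card) ≤ 64 * middleBinom (2 * m) := by
    have := middleBinom_add_le 6 (2 * m)
    rwa [show 6 + 2 * m = 2 * X₁.card by omega] at this
  have b5 : middleBinom m ^ 2 ≤ middleBinom X₁.card ^ 2 :=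
    Nat.pow_le_pow_left (middleBinom_mono (by omega)) 2
  set C := middleBinom (2 * X₁.card)
  set Q := middleBinom X₁.card ^ 2
  set f := ((X₁.powerset ×ˢ X₂.powerset).filter (fun p => TypeRel X₁.card τ₁ τ₂ p.1 p.2)).card
  -- `64C` comes from the large sets and `22C` from the small ones; the error is `10048 = 64 * 3 +
  -- 64 * 22 * 7`.
  have main : 86 * C ≤ 128 * f + 10048 * Q := by omega
  calc 86 * K * C = K * (86 * C) := by ring
    _ ≤ K * (128 * f + 10048 * Q) := by gcongr
    _ = 128 * K * f + 10048 * (K * Q) := by ring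
    _ ≤ 128 * K * f + 10048 * (4 * C) := by gcongr
    _ = _ := by ring

end EqualParts

end TwoPart

theorem theorem1p2 :
    -- the upper bound
    (∀ (α : Type u) [DecidableEq α] (X₁ X₂ : Finset α), Disjoint X₁ X₂ →
      ∀ F : Finset (Finset α), TwoPart.Is2I2S X₁ X₂ F →
        F.card ≤ TwoPart.middleBinom (X₁ ∪ X₂).card) ∧
    -- asymptotic sharpness when the first part is small
    (∀ (α : Type u) [DecidableEq α] (X₁ X₂ : ℕ → Finset α), (∀ k, Disjoint (X₁ k) (X₂ k)) →
      Tendsto (fun k => (X₁ k ∪ X₂ k).card) atTop atTop →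
      (fun k => ((X₁ k).card : ℝ)) =o[atTop] (fun k => Real.sqrt ((X₂ k).card : ℝ)) →
        ∃ F : ℕ → Finset (Finset α), (∀ k, TwoPart.Is2I2S (X₁ k) (X₂ k) (F k)) ∧
          Tendsto (fun k => ((F k).card : ℝ) / (TwoPart.middleBinom (X₁ k ∪ X₂ k).card : ℝ))
            atTop (𝓝 1)) ∧
    -- parts of equal size
    (∃ c : ℝ, 2 / 3 < c ∧ ∃ N : ℕ,
      ∀ (α : Type u) [DecidableEq α] (X₁ X₂ : Finset α), Disjoint X₁ X₂ →
        X₁.card = X₂.card → N ≤ X₁.card →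
          ∃ F : Finset (Finset α), TwoPart.Is2I2S X₁ X₂ F ∧
            c * (TwoPart.middleBinom (X₁ ∪ X₂).card : ℝ) ≤ (F.card : ℝ)) := by
  refine ⟨fun α _ X₁ X₂ hd F hF => TwoPart.card_le_middleBinom_of_sperner hd hF.subset
    (fun A hA => (hF.left A hA).2) (fun B hB => (hF.right B hB).2),
    fun α _ X₁ X₂ hd hn h => TwoPart.exists_tendsto_card_div_middleBinom X₁ X₂ hd hn h,
    -- `67/100` lies between `2/3` and `86/128`; `K = 200000` makes the error `40192 / K` less than
    -- `86 - 128 * 0.67 = 0.24`.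
    67 / 100, by norm_num, 4 * 200000 ^ 2, fun α _ X₁ X₂ hd hc hN => ?_⟩
  obtain ⟨F, hF, h⟩ := TwoPart.exists_is2I2S_of_card_eq hd hc (K := 200000) (by norm_num) hN
  refine ⟨F, hF, ?_⟩
  have h' : (86 * 200000 * TwoPart.middleBinom (X₁ ∪ X₂).card : ℝ) ≤
      128 * 200000 * F.card + 40192 * TwoPart.middleBinom (X₁ ∪ X₂).card := by exact_mod_cast h
  linarith
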